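/- For $n\ge 1$ let $X^n$ be uniform on $\{-1,1\}^n$ and let $Y^n$ be obtained from $X^n$ by flipping each coordinate independently with probability $\delta$; write $\rho=1-2\delta$ and, for $f:\{-1,1\}^n\to\{-1,1\}$, $T_\rho f(y^n)=\mathbb E\left(f(X^n)\mid Y^n=y^n\right)$. The function $f$ is called $\rho$-self-predicting ($\rho$-SP) if for every $y^n\in\{-1,1\}^n$ with $T_\rho f(y^n)\ne 0$ one has $f(y^n)=\operatorname{sgn}T_\rho f(y^n)$. Let $h(t)=-t\log_2 t-(1-t)\log_2(1-t)$ and $d(p\|q)=p\log_2\frac pq+(1-p)\log_2\frac{1-p}{1-q}$ (with $0\log_2 0=0$). For $\delta\in(0,1/2)$ let $\eta_\delta$ be the infimum of all $\eta\in(\delta,1]$ such that $$\frac12\log_2\frac1{\delta^2+(1-\delta)^2}<\min\left\{\log_2\frac1{1-\delta},\,d(\eta\|\delta)\right\},$$ and let $\delta_{\max}$ be the largest number in $[0,1/2]$ such that $\eta_\delta<1/4$ for all $\delta\in(0,\delta_{\max})$. Theorem. We have $\delta_{\max}\approx 0.0974$ (correct to four decimal places). For every $\delta\in(0,\delta_{\max})$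 we have $\delta<\eta_\delta<1/4$, and the fraction of $\rho$-SP functions, $\rho=1-2\delta$, among all $2^{2^n}$ Boolean functions on $\{-1,1\}^n$ is at most $$\exp\left(-2^{\,n[1-h(2\eta_\delta)]-o(n)}\right)\qquad(n\to\infty);$$ that is, there is a sequence $e_n=o(n)$ (which may depend on $\delta$) such that the fraction is at most $\exp\left(-2^{\,n[1-h(2\eta_\delta)]-e_n}\right)$ for all sufficiently large $n$. -/

import Mathlib

open Filter Asymptotics

noncomputable section

namespace SelfPredicting

/-- The Hamming cube `{-1,1}^n`; the alphabet `{-1,1}` is `ℤˣ`. -/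
abbrev Cube (n : ℕ) : Type := Fin n → ℤˣ

/-- Boolean functions `f : {-1,1}^n → {-1,1}`. -/
abbrev BoolFn (n : ℕ) : Type := Cube n → ℤˣ

/-- Joint probability mass function of `(X^n, Y^n)`: `X^n` is uniform on the cube and `Y^n` is
obtained by flipping each coordinate of `X^n` independently with probability `δ`. -/
def jointProb (δ : ℝ) {n : ℕ} (x y : Cube n) : ℝ :=
  (1 / 2 ^ n) * ∏ i, if x i = y i then 1 - δ else δ

/-- Conditional probability mass function `p(x^n ∣ y^n)`. -/
def condProb (δ : ℝ) {n : ℕ} (x y : Cube n) : ℝ :=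
  jointProb δ x y / ∑ z, jointProb δ z y

/-- Noise operator `T_ρ f(y) = E(f(X^n) ∣ Y^n = y)` for correlation `ρ = 1 - 2δ`,
that is, crossover probability `δ = (1 - ρ) / 2`. -/
def noiseOp (ρ : ℝ) {n : ℕ} (f : BoolFn n) (y : Cube n) : ℝ :=
  ∑ x, condProb ((1 - ρ) / 2) x y * ((f x : ℤ) : ℝ)

/-- `f` is `ρ`-self-predicting at `y`: it agrees with the optimal predictor `sgn T_ρ f(y)`
whenever that predictor is not tied. -/
def IsSPAt (ρ : ℝ) {n : ℕ} (f : BoolFn n) (y : Cube n) : Prop :=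
  noiseOp ρ f y ≠ 0 → ((f y : ℤ) : ℝ) = Real.sign (noiseOp ρ f y)

/-- `f` is `ρ`-self-predicting. -/
def IsSP (ρ : ℝ) {n : ℕ} (f : BoolFn n) : Prop :=
  ∀ y, IsSPAt ρ f y

/-- The fraction of `ρ`-self-predicting functions among all Boolean functions on `{-1,1}^n`. -/
def fractionSP (ρ : ℝ) (n : ℕ) : ℝ :=
  (Nat.card {f : BoolFn n // IsSP ρ f} : ℝ) / (Nat.card (BoolFn n) : ℝ)

/-- Binary entropy function, in bits. -/
def binEnt (t : ℝ) : ℝ :=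
  -t * Real.logb 2 t - (1 - t) * Real.logb 2 (1 - t)

/-- Binary divergence function, in bits. -/
def binDiv (p q : ℝ) : ℝ :=
  p * Real.logb 2 (p / q) + (1 - p) * Real.logb 2 ((1 - p) / (1 - q))

/-- The condition on the relative radius `η` that determines `η_δ`. -/
def EtaCondition (δ η : ℝ) : Prop :=
  (1 / 2) * Real.logb 2 (1 / (δ ^ 2 + (1 - δ) ^ 2)) <
    min (Real.logb 2 (1 / (1 - δ))) (binDiv η δ)

/-- `η_δ`: the infimum of the relative radii `η ∈ (δ, 1]` that satisfy the condition. -/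
def eta (δ : ℝ) : ℝ :=
  sInf {η : ℝ | δ < η ∧ η ≤ 1 ∧ EtaCondition δ η}

/-- `δ_max`: the largest threshold (at most `1/2`) such that `η_δ < 1/4` for every `δ` below it. -/
def deltaMax : ℝ :=
  sSup {d : ℝ | 0 ≤ d ∧ d ≤ 1 / 2 ∧ ∀ δ : ℝ, 0 < δ → δ < d → eta δ < 1 / 4}

end SelfPredicting

end

/-! For uniformly random `f`, `T_ρ f(y)` is a weighted sum of independent signs with standard
deviation `(δ² + (1-δ)²)^(n/2)`. The condition on `η` makes this exponentially larger than both the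
weight `(1-δ)^n` of `y` itself and the Chernoff bound `2^(-n d(η‖δ))` on the mass outside the ball
of radius `ηn`. With constant probability the punctured ball then dictates the sign of the
predictor, whatever `f y` is; by symmetry `f` fails at `y` with probability at least `1/8`
(`card_le_eight_mul_card_bad`, `not_isSPAt`).

The event used depends only on `f` inside the ball. The balls around a Gilbert–Varshamov code of
distance `> 2ηn` (`exists_code`) are disjoint, so these events are independent and the fraction is
at most `(7/8)^|C|` with `|C| ≥ 2^(n(1-h(2η)))` (`fractionSP_le`). Letting `η` approach `η_δ` costs
only `o(n)`. At `η = 1/4` the condition becomes a quartic inequality in `δ`, which locates `δ_max`.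
-/

namespace SelfPredicting

open Finset

/-! ### Anticoncentration of weighted sign sums -/

section Rademacher

variable {α : Type*} [DecidableEq α]

/-- The involution of `α → ℤˣ` that flips the value at `y`. -/
def flipAt (y : α) (f : α → ℤˣ) : α → ℤˣ := Function.update f y (-f y)

theorem flipAt_involutive (y : α) : Function.Involutive (flipAt y) := by
  intro f
  simp [flipAt]

@[simp] theorem flipAt_self (y : α) (f : α → ℤˣ) : flipAt y f y = -f y := by
  simp [flipAt]

theorem flipAt_of_ne {x y : α} (h : x ≠ y) (f : α → ℤˣ) : flipAt y f x = f x := by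
  simp [flipAt, h]

/-- The weighted sum of signs `∑ x ∈ s, a x * f x`. -/
noncomputable def signSum (a : α → ℝ) (s : Finset α) (f : α → ℤˣ) : ℝ :=
  ∑ x ∈ s, a x * ((f x : ℤ) : ℝ)

theorem signSum_flipAt (a : α → ℝ) {s : Finset α} {y : α} (hy : y ∉ s) (f : α → ℤˣ) :
    signSum a s (flipAt y f) = signSum a s f := by
  refine Finset.sum_congr rfl fun x hx => ?_
  rw [flipAt_of_ne (ne_of_mem_of_not_mem hx hy)]

theorem units_cast_sq (u : ℤˣ) : ((u : ℤ) : ℝ) ^ 2 = 1 := by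
  rcases Int.units_eq_one_or u with h | h <;> simp [h]

variable [Fintype α]

theorem sum_comp_flipAt (y : α) (F : (α → ℤˣ) → ℝ) :
    ∑ f, F (flipAt y f) = ∑ f, F f :=
  Equiv.sum_comp (flipAt_involutive y).toPerm F

theorem sum_signSum_sq (a : α → ℝ) (s : Finset α) :
    ∑ f, signSum a s f ^ 2 = Fintype.card (α → ℤˣ) * ∑ x ∈ s, a x ^ 2 := by
  induction s using Finset.induction_on with
  | empty => simp [signSum]
  | insert y s hy ih =>
    have h1 : ∀ f, signSum a (insert y s) f = a y * ((f y : ℤ) : ℝ) + signSum a s f := fun f => by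
      simp [signSum, Finset.sum_insert hy]
    -- Averaging each `f` with its flip at `y` cancels the odd powers of `f y`.
    have h2 : 2 * ∑ f, signSum a (insert y s) f ^ 2 = 2 * ∑ f, (a y ^ 2 + signSum a s f ^ 2) := by
      rw [two_mul]
      nth_rw 1 [← sum_comp_flipAt y]
      rw [← Finset.sum_add_distrib, Finset.mul_sum]
      refine Finset.sum_congr rfl fun f _ => ?_
      rw [h1, h1, signSum_flipAt a hy, flipAt_self]
      push_cast
      linear_combination 2 * a y ^ 2 * units_cast_sq (f y)
    have h3 := mul_left_cancel₀ two_ne_zero h2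
    rw [h3, Finset.sum_add_distrib, ih, Finset.sum_insert hy]
    simp
    ring

theorem sum_signSum_pow_four_le (a : α → ℝ) (s : Finset α) :
    ∑ f, signSum a s f ^ 4 ≤ 3 * Fintype.card (α → ℤˣ) * (∑ x ∈ s, a x ^ 2) ^ 2 := by
  induction s using Finset.induction_on with
  | empty => simp [signSum]
  | insert y s hy ih =>
    have h1 : ∀ f, signSum a (insert y s) f = a y * ((f y : ℤ) : ℝ) + signSum a s f := fun f => by
      simp [signSum, Finset.sum_insert hy]
    have h2 : 2 * ∑ f, signSum a (insert y s) f ^ 4 =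
        2 * ∑ f, (a y ^ 4 + 6 * a y ^ 2 * signSum a s f ^ 2 + signSum a s f ^ 4) := by
      rw [two_mul]
      nth_rw 1 [← sum_comp_flipAt y]
      rw [← Finset.sum_add_distrib, Finset.mul_sum]
      refine Finset.sum_congr rfl fun f _ => ?_
      rw [h1, h1, signSum_flipAt a hy, flipAt_self]
      push_cast
      linear_combination (2 * a y ^ 4 * (((f y : ℤ) : ℝ) ^ 2 + 1)
        + 12 * a y ^ 2 * signSum a s f ^ 2) * units_cast_sq (f y)
    have h3 := mul_left_cancel₀ two_ne_zero h2
    rw [h3, Finset.sum_add_distrib, Finset.sum_add_distrib, ← Finset.mul_sum, sum_signSum_sq,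
      Finset.sum_insert hy, Finset.sum_const, Finset.card_univ, nsmul_eq_mul]
    -- With `v` the old variance, `a⁴ + 6a²v + 3v² ≤ 3(a² + v)²`; the slack is `2a⁴`.
    have h4 : 0 ≤ (Fintype.card (α → ℤˣ) : ℝ) * a y ^ 4 := by positivity
    nlinarith

/-- Anticoncentration: a sum of weighted signs has absolute value larger than a small multiple of
its standard deviation with probability at least `1 / 4`. -/
theorem card_le_four_mul_card_lt_abs_signSum (a : α → ℝ) (s : Finset α) {t : ℝ}
    (hs : 0 < ∑ x ∈ s, a x ^ 2) (ht : 8 * t ^ 2 ≤ ∑ x ∈ s, a x ^ 2) :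
    (Fintype.card (α → ℤˣ) : ℝ) ≤
      4 * #{f : α → ℤˣ | t < |signSum a s f|} := by
  set v := ∑ x ∈ s, a x ^ 2 with hv
  set N : ℝ := (Fintype.card (α → ℤˣ) : ℝ) with hN
  -- On the event this follows from `(S² - 3v)² ≥ 0`. Averaging, with second moment `v`, fourth
  -- moment at most `3v²` and `t² ≤ v/8`, gives `(9/4)v² ≤ 9v²·Pr`.
  have hpt : ∀ f : α → ℤˣ, 6 * v * (signSum a s f ^ 2 - t ^ 2) ≤
      signSum a s f ^ 4 + 9 * v ^ 2 * (if t < |signSum a s f| then 1 else 0) := by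
    intro f
    split_ifs with h
    · nlinarith [sq_nonneg (signSum a s f ^ 2 - 3 * v), mul_nonneg hs.le (sq_nonneg t)]
    · have h1 : signSum a s f ^ 2 ≤ t ^ 2 := by
        rw [← sq_abs]
        exact pow_le_pow_left₀ (abs_nonneg _) (not_lt.1 h) 2
      have h2 : 0 ≤ signSum a s f ^ 4 := by positivity
      nlinarith
  have hsum := Finset.sum_le_sum fun f (_ : f ∈ (univ : Finset (α → ℤˣ))) => hpt f
  rw [← Finset.mul_sum, Finset.sum_sub_distrib, sum_signSum_sq, Finset.sum_add_distrib,
    ← Finset.mul_sum, Finset.sum_boole, Finset.sum_const, Finset.card_univ, nsmul_eq_mul,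
    ← hN, ← hv] at hsum
  have h4 := sum_signSum_pow_four_le a s
  rw [← hv, ← hN] at h4
  have hN0 : 0 ≤ N := by positivity
  have h5 : 6 * v * (N * t ^ 2) ≤ 6 * v * (N * (v / 8)) := by
    gcongr
    linarith
  have h6 : v ^ 2 * N ≤ v ^ 2 * (4 * #{f : α → ℤˣ | t < |signSum a s f|}) := by nlinarith
  exact le_of_mul_le_mul_left h6 (by positivity)

/-- Flipping `f y` leaves the sum unchanged, so the two signs of the product are equally likely and
each gets half of the `1/4`. -/
theorem card_le_eight_mul_card_mul_signSum_lt (a : α → ℝ) {s : Finset α} {y : α} (hy : y ∉ s)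
    {t : ℝ} (hs : 0 < ∑ x ∈ s, a x ^ 2) (ht : 8 * t ^ 2 ≤ ∑ x ∈ s, a x ^ 2) :
    (Fintype.card (α → ℤˣ) : ℝ) ≤
      8 * #{f : α → ℤˣ | ((f y : ℤ) : ℝ) * signSum a s f < -t} := by
  have h1 : #{f : α → ℤˣ | t < ((f y : ℤ) : ℝ) * signSum a s f} =
      #{f : α → ℤˣ | ((f y : ℤ) : ℝ) * signSum a s f < -t} := by
    refine Finset.card_bijective (flipAt y) (flipAt_involutive y).bijective fun f => ?_
    simp only [Finset.mem_filter, Finset.mem_univ, true_and, signSum_flipAt a hy, flipAt_self]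
    push_cast
    rw [neg_mul, neg_lt_neg_iff]
  have h2 : #{f : α → ℤˣ | t < |signSum a s f|} ≤
      #{f : α → ℤˣ | t < ((f y : ℤ) : ℝ) * signSum a s f} +
      #{f : α → ℤˣ | ((f y : ℤ) : ℝ) * signSum a s f < -t} := by
    refine (Finset.card_le_card fun f hf => ?_).trans (Finset.card_union_le _ _)
    simp only [Finset.mem_filter, Finset.mem_univ, true_and, Finset.mem_union] at hf ⊢
    have h3 : |signSum a s f| = |((f y : ℤ) : ℝ) * signSum a s f| := by
      rcases Int.units_eq_one_or (f y) with h | h <;> simp [h]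
    rw [h3, lt_abs] at hf
    rcases hf with hf | hf
    · exact Or.inl hf
    · exact Or.inr (by linarith)
  have h4 := card_le_four_mul_card_lt_abs_signSum a s hs ht
  have h5 : (#{f : α → ℤˣ | t < |signSum a s f|} : ℝ) ≤
      2 * #{f : α → ℤˣ | ((f y : ℤ) : ℝ) * signSum a s f < -t} := by
    have h6 := h2
    rw [h1, ← two_mul] at h6
    exact_mod_cast h6
  linarith

end Rademacher

/-! ### Independence of events on disjoint coordinates -/

section Independence

variable {α β ι : Type*} [Fintype α] [DecidableEq α] [Fintype β]

/-- Events that depend on disjoint sets of coordinates are independent under the uniform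
distribution. -/
theorem card_and_mul_card (P Q : (α → β) → Prop) [DecidablePred P] [DecidablePred Q]
    (S : Finset α) (hP : ∀ f g, (∀ x ∈ S, f x = g x) → (P f ↔ P g))
    (hQ : ∀ f g, (∀ x ∉ S, f x = g x) → (Q f ↔ Q g)) :
    #{f : α → β | P f ∧ Q f} * Fintype.card (α → β) = #{f : α → β | P f} * #{f : α → β | Q f} := by
  rw [← Finset.card_univ, ← Finset.card_product, ← Finset.card_product]
  -- Exchanging two samples off `S` moves the test of `Q` to the second sample and leaves that of
  -- `P` on the first.
  let sw : (α → β) × (α → β) → (α → β) × (α → β) := fun p =>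
    (fun x => if x ∈ S then p.1 x else p.2 x, fun x => if x ∈ S then p.2 x else p.1 x)
  have hsw : Function.Involutive sw := by
    rintro ⟨f, g⟩
    ext x <;> by_cases hx : x ∈ S <;> simp [sw, hx]
  refine Finset.card_bijective sw hsw.bijective fun p => ?_
  have h1 : P (sw p).1 ↔ P p.1 := hP _ _ fun x hx => by simp [sw, hx]
  have h2 : Q (sw p).2 ↔ Q p.1 := hQ _ _ fun x hx => by simp [sw, hx]
  simp [h1, h2]

theorem card_forall_le_pow_mul_card [Nonempty β] [DecidableEq ι] (C : Finset ι)
    (P : ι → (α → β) → Prop) [∀ i, DecidablePred (P i)] (B : ι → Finset α)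
    (hB : ∀ i ∈ C, ∀ j ∈ C, i ≠ j → Disjoint (B i) (B j))
    (hP : ∀ i f g, (∀ x ∈ B i, f x = g x) → (P i f ↔ P i g)) {c : ℝ}
    (hc : ∀ i ∈ C, (#{f : α → β | P i f} : ℝ) ≤ c * Fintype.card (α → β)) :
    (#{f : α → β | ∀ i ∈ C, P i f} : ℝ) ≤ c ^ #C * Fintype.card (α → β) := by
  induction C using Finset.induction_on with
  | empty => simp
  | insert j C hj ih =>
    have hN : (0 : ℝ) < Fintype.card (α → β) := by exact_mod_cast Fintype.card_pos
    have ih' := ih (fun i hi k hk => hB i (mem_insert_of_mem hi) k (mem_insert_of_mem hk))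
      (fun i hi => hc i (mem_insert_of_mem hi))
    have hj' := hc j (mem_insert_self _ _)
    have hc0 : 0 ≤ c := by
      by_contra h
      have : c * (Fintype.card (α → β) : ℝ) < 0 := mul_neg_of_neg_of_pos (not_le.1 h) hN
      have : (0 : ℝ) ≤ #{f : α → β | P j f} := by positivity
      linarith
    have hind := card_and_mul_card (P j) (fun f => ∀ i ∈ C, P i f) (B j) (hP j) (by
      intro f g hfg
      refine forall₂_congr fun i hi => hP i f g fun x hx => hfg x fun hxj => ?_
      exact Finset.disjoint_left.1 (hB i (mem_insert_of_mem hi) j (mem_insert_self _ _)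
        (fun h => hj (h ▸ hi))) hx hxj)
    have hind' : (#{f : α → β | P j f ∧ ∀ i ∈ C, P i f} : ℝ) * Fintype.card (α → β) =
        #{f : α → β | P j f} * #{f : α → β | ∀ i ∈ C, P i f} := by exact_mod_cast hind
    have hle : (#{f : α → β | P j f} : ℝ) * #{f : α → β | ∀ i ∈ C, P i f} ≤
        (c * Fintype.card (α → β)) * (c ^ #C * Fintype.card (α → β)) :=
      mul_le_mul hj' ih' (by positivity) (by positivity)
    simp only [Finset.forall_mem_insert, Finset.card_insert_of_notMem hj]
    refine le_of_mul_le_mul_right (a := (Fintype.card (α → β) : ℝ)) ?_ hN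
    rw [hind']
    refine hle.trans_eq ?_
    ring

end Independence

/-! ### Noise weights, Chernoff and volume bounds, codes -/

theorem sum_prod_ite_eq {n : ℕ} (a b : ℝ) (y : Cube n) :
    ∑ x : Cube n, ∏ i, (if x i = y i then a else b) = (a + b) ^ n := by
  have h := Finset.prod_univ_sum (fun _ : Fin n => (univ : Finset ℤˣ))
    (fun i u => if u = y i then a else b)
  rw [Fintype.piFinset_univ] at h
  rw [← h]
  have h1 : ∀ i, ∑ u : ℤˣ, (if u = y i then a else b) = a + b := by
    intro i
    have hu : (univ : Finset ℤˣ) = {1, -1} := rfl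
    have hne : (1 : ℤˣ) ≠ -1 := by decide
    rw [hu, Finset.sum_pair hne]
    rcases Int.units_eq_one_or (y i) with h | h
    · rw [h, if_pos rfl, if_neg hne.symm]
    · rw [h, if_pos rfl, if_neg hne, add_comm]
  rw [Finset.prod_congr rfl fun i _ => h1 i]
  simp

/-- Probability that the noise with crossover probability `δ` takes `y` to `x`. -/
noncomputable def weight (δ : ℝ) {n : ℕ} (x y : Cube n) : ℝ :=
  ∏ i, if x i = y i then 1 - δ else δ

theorem sum_weight (δ : ℝ) {n : ℕ} (y : Cube n) : ∑ x, weight δ x y = 1 := by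
  simp [weight, sum_prod_ite_eq]

theorem sum_weight_sq (δ : ℝ) {n : ℕ} (y : Cube n) :
    ∑ x, weight δ x y ^ 2 = (δ ^ 2 + (1 - δ) ^ 2) ^ n := by
  rw [add_comm, ← sum_prod_ite_eq _ _ y]
  refine Finset.sum_congr rfl fun x _ => ?_
  rw [weight, ← Finset.prod_pow]
  exact Finset.prod_congr rfl fun i _ => by split_ifs <;> rfl

theorem weight_self (δ : ℝ) {n : ℕ} (y : Cube n) : weight δ y y = (1 - δ) ^ n := by
  simp [weight]

theorem weight_pos {δ : ℝ} (h0 : 0 < δ) (h1 : δ < 1) {n : ℕ} (x y : Cube n) :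
    0 < weight δ x y :=
  Finset.prod_pos fun i _ => by split_ifs <;> linarith

theorem log_weight {δ : ℝ} (h0 : 0 < δ) (h1 : δ < 1) {n : ℕ} (x y : Cube n) :
    Real.log (weight δ x y) =
      (n - hammingDist x y) * Real.log (1 - δ) + hammingDist x y * Real.log δ := by
  rw [weight, Real.log_prod (fun i _ => by split_ifs <;> linarith)]
  have h : ∀ i, Real.log (if x i = y i then 1 - δ else δ) =
      Real.log (1 - δ) + if x i ≠ y i then Real.log δ - Real.log (1 - δ) else 0 := by
    intro i
    by_cases h : x i = y i <;> simp [h]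
  simp only [h, Finset.sum_add_distrib, ← Finset.sum_filter, Finset.sum_const, nsmul_eq_mul,
    hammingDist, Finset.card_univ, Fintype.card_fin]
  ring

theorem condProb_eq_weight (δ : ℝ) {n : ℕ} (x y : Cube n) : condProb δ x y = weight δ x y := by
  have h : ∑ z, jointProb δ z y = 1 / 2 ^ n := by
    have := sum_weight δ y
    simp only [jointProb, ← Finset.mul_sum]
    rw [show ∑ z : Cube n, ∏ i, (if z i = y i then 1 - δ else δ) = 1 from this, mul_one]
  rw [condProb, h, jointProb, weight]
  field_simp

theorem log_two_mul_binDiv {p q : ℝ} (hp0 : 0 < p) (hp1 : p < 1) (hq0 : 0 < q) (hq1 : q < 1) :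
    Real.log 2 * binDiv p q = p * (Real.log p - Real.log q) +
      (1 - p) * (Real.log (1 - p) - Real.log (1 - q)) := by
  have h2 : Real.log 2 ≠ 0 := (Real.log_pos one_lt_two).ne'
  rw [binDiv, Real.logb, Real.logb, Real.log_div hp0.ne' hq0.ne',
    Real.log_div (by linarith) (by linarith)]
  field_simp

theorem log_two_mul_binEnt (t : ℝ) :
    Real.log 2 * binEnt t = -t * Real.log t - (1 - t) * Real.log (1 - t) := by
  have h2 : Real.log 2 ≠ 0 := (Real.log_pos one_lt_two).ne'
  rw [binEnt, Real.logb, Real.logb]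
  field_simp

/-- Chernoff bound: the noise leaves the ball of relative radius `η` with probability at most
`2 ^ (-n d(η ‖ δ))`. -/
theorem sum_weight_far_le {δ η : ℝ} (h0 : 0 < δ) (hδη : δ < η) (hη : η < 1) {n : ℕ} (y : Cube n) :
    ∑ x with ¬ (hammingDist x y : ℝ) ≤ η * n, weight δ x y ≤ ((2 : ℝ) ^ (-binDiv η δ)) ^ n := by
  have hq : (0 : ℝ) < ((2 : ℝ) ^ (-binDiv η δ)) ^ n := by positivity
  have hη0 : 0 < η := h0.trans hδη
  have hδ1 : δ < 1 := hδη.trans hη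
  calc ∑ x with ¬ (hammingDist x y : ℝ) ≤ η * n, weight δ x y
      ≤ ∑ x with ¬ (hammingDist x y : ℝ) ≤ η * n,
          ((2 : ℝ) ^ (-binDiv η δ)) ^ n * weight η x y := by
        -- Change of measure: `weight δ / weight η` decreases with the distance and equals `2^(-n
        -- d(η‖δ))` at distance `ηn`.
        refine Finset.sum_le_sum fun x hx => ?_
        simp only [Finset.mem_filter, Finset.mem_univ, true_and, not_le] at hx
        have hw := weight_pos hη0 hη x y
        rw [← Real.log_le_log_iff (weight_pos h0 hδ1 x y) (by positivity),
          Real.log_mul hq.ne' hw.ne', Real.log_pow, Real.log_rpow two_pos,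
          log_weight h0 hδ1, log_weight hη0 hη]
        have hD := log_two_mul_binDiv hη0 hη h0 hδ1
        have hl1 : Real.log δ ≤ Real.log η := Real.log_le_log h0 hδη.le
        have hl2 : Real.log (1 - η) ≤ Real.log (1 - δ) :=
          Real.log_le_log (by linarith) (by linarith)
        have hm := mul_nonneg (sub_nonneg.2 hx.le)
          (add_nonneg (sub_nonneg.2 hl1) (sub_nonneg.2 hl2))
        linear_combination hm + (n : ℝ) * hD
    _ ≤ ∑ x, ((2 : ℝ) ^ (-binDiv η δ)) ^ n * weight η x y :=
        Finset.sum_le_sum_of_subset_of_nonneg (Finset.filter_subset _ _) fun x _ _ =>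
          mul_nonneg hq.le (weight_pos hη0 hη x y).le
    _ = _ := by rw [← Finset.mul_sum, sum_weight, mul_one]

/-- Entropy bound on the volume of a Hamming ball. -/
theorem card_ball_le {l : ℝ} (h0 : 0 < l) (h1 : l ≤ 1 / 2) {n : ℕ} (y : Cube n) :
    (#{x : Cube n | (hammingDist x y : ℝ) ≤ l * n} : ℝ) ≤ (2 : ℝ) ^ (n * binEnt l) := by
  have hl1 : l < 1 := by linarith
  have hq : (0 : ℝ) < (2 : ℝ) ^ (n * binEnt l) := by positivity
  calc (#{x : Cube n | (hammingDist x y : ℝ) ≤ l * n} : ℝ)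
      = ∑ x with (hammingDist x y : ℝ) ≤ l * n, (1 : ℝ) := by simp
    _ ≤ ∑ x with (hammingDist x y : ℝ) ≤ l * n, (2 : ℝ) ^ (n * binEnt l) * weight l x y := by
        -- As `l ≤ 1/2`, `weight l` is nonincreasing in the distance; at distance `ln` it is `2^(-n
        -- h(l))`.
        refine Finset.sum_le_sum fun x hx => ?_
        simp only [Finset.mem_filter, Finset.mem_univ, true_and] at hx
        have hw := weight_pos h0 hl1 x y
        rw [← Real.log_le_log_iff one_pos (by positivity), Real.log_one,
          Real.log_mul hq.ne' hw.ne', Real.log_rpow two_pos, log_weight h0 hl1]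
        have hE := log_two_mul_binEnt l
        have hl : Real.log l ≤ Real.log (1 - l) := Real.log_le_log h0 (by linarith)
        have hm := mul_nonneg (sub_nonneg.2 hx) (sub_nonneg.2 hl)
        linear_combination hm - (n : ℝ) * hE
    _ ≤ ∑ x, (2 : ℝ) ^ (n * binEnt l) * weight l x y :=
        Finset.sum_le_sum_of_subset_of_nonneg (Finset.filter_subset _ _) fun x _ _ =>
          mul_nonneg hq.le (weight_pos h0 hl1 x y).le
    _ = _ := by rw [← Finset.mul_sum, sum_weight, mul_one]

/-- Gilbert–Varshamov bound. -/
theorem exists_code {l : ℝ} (h0 : 0 < l) (h1 : l ≤ 1 / 2) (n : ℕ) :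
    ∃ C : Finset (Cube n), (∀ x ∈ C, ∀ y ∈ C, x ≠ y → l * n < hammingDist x y) ∧
      (2 : ℝ) ^ (n * (1 - binEnt l)) ≤ #C := by
  classical
  obtain ⟨C, hC, hmax⟩ := Finset.exists_max_image
    ({C : Finset (Cube n) | ∀ x ∈ C, ∀ y ∈ C, x ≠ y → l * n < hammingDist x y} :
      Finset (Finset (Cube n))) Finset.card ⟨∅, by simp⟩
  simp only [Finset.mem_filter, Finset.mem_univ, true_and] at hC hmax
  refine ⟨C, hC, ?_⟩
  -- An uncovered point could be added to the maximal code.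
  have hcov : ∀ x, ∃ y ∈ C, (hammingDist x y : ℝ) ≤ l * n := by
    intro x
    by_contra! hx
    have hxC : x ∉ C := fun h => by
      have := hx x h
      rw [hammingDist_self] at this
      have : 0 ≤ l * n := by positivity
      push_cast at *
      linarith
    have := hmax (insert x C) (by
      intro u hu v hv huv
      rcases Finset.mem_insert.1 hu with rfl | huC <;>
        rcases Finset.mem_insert.1 hv with rfl | hvC
      · exact absurd rfl huv
      · exact hx v hvC
      · rw [hammingDist_comm]
        exact hx u huC
      · exact hC u huC v hvC huv)
    rw [Finset.card_insert_of_notMem hxC] at this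
    omega
  have hcard : (2 : ℝ) ^ n ≤ #C * (2 : ℝ) ^ (n * binEnt l) := by
    calc (2 : ℝ) ^ n = #(univ : Finset (Cube n)) := by simp
      _ ≤ #(C.biUnion fun y => {x : Cube n | (hammingDist x y : ℝ) ≤ l * n}) := by
          refine Nat.cast_le.2 (Finset.card_le_card fun x _ => ?_)
          simpa using hcov x
      _ ≤ ∑ y ∈ C, (#{x : Cube n | (hammingDist x y : ℝ) ≤ l * n} : ℝ) := by
          exact_mod_cast Finset.card_biUnion_le
      _ ≤ ∑ y ∈ C, (2 : ℝ) ^ (n * binEnt l) := Finset.sum_le_sum fun y _ => card_ball_le h0 h1 y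
      _ = _ := by simp
  rw [mul_sub, mul_one, Real.rpow_sub two_pos, Real.rpow_natCast,
    div_le_iff₀ (by positivity)]
  exact hcard

end SelfPredicting

/-! ### The radius `η_δ` and the threshold `δ_max` -/

namespace SelfPredicting

/-- The exponential decay rate of the standard deviation of `T_ρ f(y)` for random `f`. -/
noncomputable def threshold (δ : ℝ) : ℝ :=
  (1 / 2) * Real.logb 2 (1 / (δ ^ 2 + (1 - δ) ^ 2))

theorem log_two_mul_threshold (δ : ℝ) :
    Real.log 2 * threshold δ = -(1 / 2) * Real.log (δ ^ 2 + (1 - δ) ^ 2) := by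
  have h2 : Real.log 2 ≠ 0 := (Real.log_pos one_lt_two).ne'
  rw [threshold, Real.logb, one_div (δ ^ 2 + (1 - δ) ^ 2), Real.log_inv]
  field_simp

theorem sq_add_sq_one_sub_pos (δ : ℝ) : 0 < δ ^ 2 + (1 - δ) ^ 2 := by
  nlinarith [sq_nonneg (2 * δ - 1)]

theorem threshold_pos {δ : ℝ} (h0 : 0 < δ) (h1 : δ < 1) : 0 < threshold δ := by
  have h2 : 0 < Real.log 2 := Real.log_pos one_lt_two
  have h3 : Real.log (δ ^ 2 + (1 - δ) ^ 2) < 0 :=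
    Real.log_neg (sq_add_sq_one_sub_pos δ) (by nlinarith)
  have h4 := log_two_mul_threshold δ
  exact pos_of_mul_pos_right (b := threshold δ) (by rw [h4]; linarith) h2.le

/-- The other term of the minimum never binds, because `(1-δ)² < δ² + (1-δ)²`. -/
theorem etaCondition_iff {δ : ℝ} (h0 : 0 < δ) (h1 : δ < 1) (η : ℝ) :
    EtaCondition δ η ↔ threshold δ < binDiv η δ := by
  have h2 : 0 < Real.log 2 := Real.log_pos one_lt_two
  have h : threshold δ < Real.logb 2 (1 / (1 - δ)) := by
    refine lt_of_mul_lt_mul_left ?_ h2.le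
    rw [log_two_mul_threshold, Real.logb, mul_div_cancel₀ _ h2.ne', one_div (1 - δ), Real.log_inv]
    have h3 : Real.log ((1 - δ) ^ 2) < Real.log (δ ^ 2 + (1 - δ) ^ 2) :=
      Real.log_lt_log (pow_pos (by linarith) 2) (by nlinarith)
    rw [Real.log_pow] at h3
    push_cast at h3
    linarith
  rw [EtaCondition, lt_min_iff]
  exact ⟨fun hh => hh.2, fun hh => ⟨h, hh⟩⟩

theorem binDiv_eq {δ : ℝ} (h0 : 0 < δ) (h1 : δ < 1) (η : ℝ) :
    binDiv η δ =
      (-Real.binEntropy η - η * Real.log δ - (1 - η) * Real.log (1 - δ)) / Real.log 2 := by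
  have h2 : Real.log 2 ≠ 0 := (Real.log_pos one_lt_two).ne'
  have key : ∀ p q : ℝ, 0 < q → p * Real.log (p / q) = p * Real.log p - p * Real.log q := by
    intro p q hq
    rcases eq_or_ne p 0 with rfl | hp
    · simp
    · rw [Real.log_div hp hq.ne', mul_sub]
  rw [binDiv, Real.logb, Real.logb, Real.binEntropy, Real.log_inv, Real.log_inv,
    eq_div_iff h2, add_mul, mul_assoc, mul_assoc, div_mul_cancel₀ _ h2, div_mul_cancel₀ _ h2,
    key _ _ h0, key _ _ (by linarith)]
  ring

theorem continuous_binDiv {δ : ℝ} (h0 : 0 < δ) (h1 : δ < 1) :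
    Continuous fun η => binDiv η δ := by
  simp only [binDiv_eq h0 h1]
  fun_prop

theorem binEnt_eq (t : ℝ) : binEnt t = Real.binEntropy t / Real.log 2 := by
  have h2 : Real.log 2 ≠ 0 := (Real.log_pos one_lt_two).ne'
  rw [eq_div_iff h2, mul_comm, log_two_mul_binEnt, Real.binEntropy, Real.log_inv, Real.log_inv]
  ring

theorem continuous_binEnt : Continuous binEnt := by
  rw [show binEnt = fun t => Real.binEntropy t / Real.log 2 from funext binEnt_eq]
  fun_prop

theorem convexOn_binDiv {δ : ℝ} (h0 : 0 < δ) (h1 : δ < 1) :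
    ConvexOn ℝ (Set.Icc 0 1) fun η => binDiv η δ := by
  have h2 : 0 < Real.log 2 := Real.log_pos one_lt_two
  refine ⟨convex_Icc 0 1, fun x hx y hy a b ha hb hab => ?_⟩
  have hc := Real.strictConcave_binEntropy.concaveOn.2 hx hy ha hb hab
  simp only [binDiv_eq h0 h1, smul_eq_mul] at hc ⊢
  rw [← mul_div_assoc, ← mul_div_assoc, ← add_div]
  gcongr
  obtain rfl : b = 1 - a := by linarith
  linarith

theorem binDiv_self {δ : ℝ} (h0 : 0 < δ) (h1 : δ < 1) : binDiv δ δ = 0 := by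
  rw [binDiv, div_self h0.ne', div_self (by linarith)]
  simp

/-- The radii that compete for `η_δ`. -/
def etaSet (δ : ℝ) : Set ℝ := {η : ℝ | δ < η ∧ η ≤ 1 ∧ EtaCondition δ η}

theorem etaSet_bddBelow (δ : ℝ) : BddBelow (etaSet δ) := ⟨δ, fun _ h => h.1.le⟩

theorem etaSet_nonempty {δ : ℝ} (h0 : 0 < δ) (h1 : δ < 1) : (etaSet δ).Nonempty := by
  refine ⟨1, h1, le_rfl, (etaCondition_iff h0 h1 1).2 ?_⟩
  have h2 : 0 < Real.log 2 := Real.log_pos one_lt_two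
  refine lt_of_mul_lt_mul_left ?_ h2.le
  rw [log_two_mul_threshold, binDiv_eq h0 h1, mul_div_cancel₀ _ h2.ne']
  have h3 : Real.log (δ ^ 2) < Real.log (δ ^ 2 + (1 - δ) ^ 2) :=
    Real.log_lt_log (by positivity) (by nlinarith)
  rw [Real.log_pow] at h3
  push_cast at h3
  simp only [Real.binEntropy_one]
  linarith

/-- The divergence vanishes at `η = δ`, so by continuity it stays below the positive threshold
nearby. -/
theorem lt_eta {δ : ℝ} (h0 : 0 < δ) (h1 : δ < 1) : δ < eta δ := by
  have hev : ∀ᶠ η in nhds δ, binDiv η δ < threshold δ :=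
    (continuous_binDiv h0 h1).continuousAt.eventually_lt continuousAt_const
      (by rw [binDiv_self h0 h1]; exact threshold_pos h0 h1)
  obtain ⟨r, hr, hball⟩ := Metric.eventually_nhds_iff.1 hev
  refine lt_of_lt_of_le (b := δ + r) (by linarith) ?_
  refine le_csInf (etaSet_nonempty h0 h1) fun η hη => ?_
  by_contra! hlt
  have h3 := hball (y := η) (by rw [Real.dist_eq, abs_lt]; constructor <;> linarith [hη.1])
  exact absurd ((etaCondition_iff h0 h1 η).1 hη.2.2) (not_lt.2 h3.le)

theorem log_two_mul_binDiv_quarter_sub_threshold {δ : ℝ} (h0 : 0 < δ) (h1 : δ < 1) :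
    4 * (Real.log 2 * (binDiv (1 / 4) δ - threshold δ)) =
      Real.log (27 * (δ ^ 2 + (1 - δ) ^ 2) ^ 2) - Real.log (256 * (δ * (1 - δ) ^ 3)) := by
  have hδ : 0 < 1 - δ := by linarith
  have hs := sq_add_sq_one_sub_pos δ
  rw [mul_sub, log_two_mul_threshold,
    log_two_mul_binDiv (by norm_num) (by norm_num) h0 h1, Real.log_mul (by norm_num) (by positivity),
    Real.log_mul (by norm_num) (by positivity), Real.log_mul h0.ne' (by positivity), Real.log_pow,
    Real.log_pow, show (1 : ℝ) - 1 / 4 = 3 / 4 by norm_num,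
    Real.log_div (by norm_num) (by norm_num), Real.log_div (by norm_num) (by norm_num),
    show (27 : ℝ) = 3 ^ 3 by norm_num, show (256 : ℝ) = 4 ^ 4 by norm_num, Real.log_pow,
    Real.log_pow, Real.log_one]
  push_cast
  ring

theorem threshold_lt_binDiv_quarter {δ : ℝ} (h0 : 0 < δ) (h1 : δ < 1)
    (h : 256 * (δ * (1 - δ) ^ 3) < 27 * (δ ^ 2 + (1 - δ) ^ 2) ^ 2) :
    threshold δ < binDiv (1 / 4) δ := by
  have h2 : 0 < Real.log 2 := Real.log_pos one_lt_two
  have hδ : 0 < 1 - δ := by linarith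
  have h3 := log_two_mul_binDiv_quarter_sub_threshold h0 h1
  have h4 := Real.log_lt_log (by positivity) h
  have h5 : 0 < Real.log 2 * (binDiv (1 / 4) δ - threshold δ) := by linarith
  exact sub_pos.1 (pos_of_mul_pos_right h5 h2.le)

theorem binDiv_quarter_le_threshold {δ : ℝ} (h0 : 0 < δ) (h1 : δ < 1)
    (h : 27 * (δ ^ 2 + (1 - δ) ^ 2) ^ 2 ≤ 256 * (δ * (1 - δ) ^ 3)) :
    binDiv (1 / 4) δ ≤ threshold δ := by
  have h2 : 0 < Real.log 2 := Real.log_pos one_lt_two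
  have hs := sq_add_sq_one_sub_pos δ
  have h3 := log_two_mul_binDiv_quarter_sub_threshold h0 h1
  have h4 := Real.log_le_log (by positivity) h
  have h5 : Real.log 2 * (binDiv (1 / 4) δ - threshold δ) ≤ 0 := by linarith
  by_contra! hlt
  exact absurd (mul_pos h2 (sub_pos.2 hlt)) (not_lt.2 h5)

theorem eta_lt_quarter {δ : ℝ} (h0 : 0 < δ) (h1 : δ < 1 / 4)
    (h : 256 * (δ * (1 - δ) ^ 3) < 27 * (δ ^ 2 + (1 - δ) ^ 2) ^ 2) : eta δ < 1 / 4 := by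
  have hδ : δ < 1 := by linarith
  -- Continuity supplies an admissible radius strictly below `1/4`.
  have hev : ∀ᶠ η in nhds (1 / 4 : ℝ), threshold δ < binDiv η δ :=
    continuousAt_const.eventually_lt (continuous_binDiv h0 hδ).continuousAt
      (threshold_lt_binDiv_quarter h0 hδ h)
  obtain ⟨η, ⟨hη1, hη2⟩, hη3⟩ := ((hev.and (lt_mem_nhds h1)).filter_mono nhdsWithin_le_nhds
    |>.and (self_mem_nhdsWithin (a := (1 / 4 : ℝ)) (s := Set.Iio (1 / 4)))).exists
  have hη4 : η < 1 / 4 := hη3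
  refine lt_of_le_of_lt (csInf_le (etaSet_bddBelow δ) ?_) hη4
  exact ⟨hη2, by linarith, (etaCondition_iff h0 hδ η).2 hη1⟩

theorem quarter_le_eta {δ : ℝ} (h0 : 0 < δ) (h1 : δ < 1 / 4)
    (h : 27 * (δ ^ 2 + (1 - δ) ^ 2) ^ 2 ≤ 256 * (δ * (1 - δ) ^ 3)) : 1 / 4 ≤ eta δ := by
  have hδ : δ < 1 := by linarith
  refine le_csInf (etaSet_nonempty h0 hδ) fun η hη => ?_
  by_contra! hlt
  -- By convexity, a divergence below the threshold at both ends is below it throughout `[δ, 1/4]`.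
  have hmax := (convexOn_binDiv h0 hδ).le_max_of_mem_Icc (x := δ) (y := 1 / 4) (z := η)
    ⟨h0.le, hδ.le⟩ ⟨by norm_num, by norm_num⟩ ⟨hη.1.le, hlt.le⟩
  simp only [binDiv_self h0 hδ] at hmax
  have h2 : binDiv η δ ≤ threshold δ :=
    hmax.trans (max_le (threshold_pos h0 hδ).le (binDiv_quarter_le_threshold h0 hδ h))
  exact absurd ((etaCondition_iff h0 hδ η).1 hη.2.2) (not_lt.2 h2)

theorem polynomial_lt {δ : ℝ} (h0 : 0 < δ) (h1 : δ ≤ 0.09735) :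
    256 * (δ * (1 - δ) ^ 3) < 27 * (δ ^ 2 + (1 - δ) ^ 2) ^ 2 := by
  -- Right minus left side is `p(δ) = 364δ⁴ - 984δ³ + 984δ² - 364δ + 27`; `hq` and `hp` bound the
  -- cofactor of `0.09735 - δ` in `p(δ) - p(0.09735)`.
  have hq : 0 ≤ 364 - 984 * (0.09735 + δ) - 364 * (0.09735 + δ) * (0.09735 ^ 2 + δ ^ 2) := by
    norm_num at h1 ⊢
    nlinarith
  have hp : 0 ≤ 984 * (0.09735 ^ 2 + 0.09735 * δ + δ ^ 2) := by positivity
  have hm := mul_nonneg (sub_nonneg.2 h1) (add_nonneg hq hp)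
  norm_num at hm ⊢
  linarith

theorem abs_deltaMax_sub_le : |deltaMax - 0.0974| ≤ 0.00005 := by
  have hlow : (0.09735 : ℝ) ≤ deltaMax := by
    refine le_csSup ⟨1 / 2, fun d hd => hd.2.1⟩ ⟨by norm_num, by norm_num, fun δ h0 hδ => ?_⟩
    refine eta_lt_quarter h0 (hδ.trans (by norm_num)) (polynomial_lt h0 hδ.le)
  have hup : deltaMax ≤ 0.09745 := by
    refine csSup_le ⟨0, le_rfl, by norm_num, fun δ h0 hδ => absurd h0 (not_lt.2 hδ.le)⟩ ?_
    intro d hd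
    by_contra! hlt
    refine absurd (hd.2.2 0.09745 (by norm_num) hlt) (not_lt.2 ?_)
    exact quarter_le_eta (by norm_num) (by norm_num) (by norm_num)
  rw [abs_le]
  constructor <;> norm_num at hlow hup ⊢ <;> linarith

theorem eta_lt_quarter_of_lt_deltaMax {δ : ℝ} (h0 : 0 < δ) (h : δ < deltaMax) :
    δ < 1 / 2 ∧ eta δ < 1 / 4 := by
  obtain ⟨d, hd, hδ⟩ := exists_lt_of_lt_csSup
    (⟨0, le_rfl, by norm_num, fun δ h0 hδ => absurd h0 (not_lt.2 hδ.le)⟩ :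
      {d : ℝ | 0 ≤ d ∧ d ≤ 1 / 2 ∧ ∀ δ : ℝ, 0 < δ → δ < d → eta δ < 1 / 4}.Nonempty) h
  exact ⟨hδ.trans_le hd.2.1, hd.2.2 δ h0 hδ⟩

end SelfPredicting

/-! ### Failure events and the bound on the fraction -/

namespace SelfPredicting

open Finset

/-- The punctured Hamming ball of relative radius `η`. -/
noncomputable def puncturedBall (η : ℝ) {n : ℕ} (y : Cube n) : Finset (Cube n) :=
  ({x : Cube n | (hammingDist x y : ℝ) ≤ η * n} : Finset (Cube n)).erase y

theorem sum_eq_puncturedBall {η : ℝ} (hη : 0 ≤ η) {n : ℕ} (y : Cube n) (F : Cube n → ℝ) :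
    ∑ x, F x = F y + ∑ x ∈ puncturedBall η y, F x +
      ∑ x with ¬ (hammingDist x y : ℝ) ≤ η * n, F x := by
  have hy : y ∈ ({x : Cube n | (hammingDist x y : ℝ) ≤ η * n} : Finset (Cube n)) := by
    simp only [Finset.mem_filter, Finset.mem_univ, true_and, hammingDist_self, Nat.cast_zero]
    positivity
  rw [puncturedBall, Finset.add_sum_erase _ F hy, Finset.sum_filter_add_sum_filter_not]

/-- If the contribution of the punctured ball outweighs everything else and has the sign opposite
to `f y`, then `f` is not self-predicting at `y`. -/
theorem not_isSPAt {δ η : ℝ} (h0 : 0 < δ) (h1 : δ < 1) (hη : 0 ≤ η) {n : ℕ} {f : BoolFn n}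
    {y : Cube n} {t : ℝ}
    (ht : weight δ y y + ∑ x with ¬ (hammingDist x y : ℝ) ≤ η * n, weight δ x y ≤ t)
    (hf : ((f y : ℤ) : ℝ) * signSum (fun x => weight δ x y) (puncturedBall η y) f < -t) :
    ¬ IsSPAt (1 - 2 * δ) f y := by
  have hT : noiseOp (1 - 2 * δ) f y = weight δ y y * ((f y : ℤ) : ℝ) +
      signSum (fun x => weight δ x y) (puncturedBall η y) f +
      ∑ x with ¬ (hammingDist x y : ℝ) ≤ η * n, weight δ x y * ((f x : ℤ) : ℝ) := by
    rw [noiseOp, show (1 - (1 - 2 * δ)) / 2 = δ by ring]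
    simp only [condProb_eq_weight]
    exact sum_eq_puncturedBall hη y fun x => weight δ x y * ((f x : ℤ) : ℝ)
  have hfar : |∑ x with ¬ (hammingDist x y : ℝ) ≤ η * n, weight δ x y * ((f x : ℤ) : ℝ)| ≤
      ∑ x with ¬ (hammingDist x y : ℝ) ≤ η * n, weight δ x y := by
    refine (Finset.abs_sum_le_sum_abs _ _).trans (Finset.sum_le_sum fun x _ => ?_)
    rw [abs_mul, abs_of_pos (weight_pos h0 h1 x y)]
    rcases Int.units_eq_one_or (f x) with h | h <;> simp [h]
  obtain ⟨hfar1, hfar2⟩ := abs_le.1 hfar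
  intro hsp
  rcases Int.units_eq_one_or (f y) with h | h
  · rw [h] at hT hf
    push_cast at hT hf
    have hneg : noiseOp (1 - 2 * δ) f y < 0 := by rw [hT]; linarith
    have := hsp hneg.ne
    rw [Real.sign_of_neg hneg, h] at this
    norm_num at this
  · rw [h] at hT hf
    push_cast at hT hf
    have hpos : 0 < noiseOp (1 - 2 * δ) f y := by rw [hT]; linarith
    have := hsp hpos.ne'
    rw [Real.sign_of_pos hpos, h] at this
    norm_num at this

/-- The bad event at `y` has probability at least `1 / 8` once the standard deviation dominates
the weight of `y` and of the complement of the ball. -/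
theorem card_le_eight_mul_card_bad {δ η : ℝ} (h0 : 0 < δ) (h1 : δ < 1) (hη : 0 ≤ η) {n : ℕ}
    (y : Cube n) {t : ℝ}
    (ht : weight δ y y + ∑ x with ¬ (hammingDist x y : ℝ) ≤ η * n, weight δ x y ≤ t)
    (htn : 16 * t ^ 2 ≤ (δ ^ 2 + (1 - δ) ^ 2) ^ n) :
    (Fintype.card (BoolFn n) : ℝ) ≤ 8 * #{f : BoolFn n |
      ((f y : ℤ) : ℝ) * signSum (fun x => weight δ x y) (puncturedBall η y) f < -t} := by
  have hw : ∀ x, 0 ≤ weight δ x y := fun x => (weight_pos h0 h1 x y).le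
  have hfar0 : 0 ≤ ∑ x with ¬ (hammingDist x y : ℝ) ≤ η * n, weight δ x y :=
    Finset.sum_nonneg fun x _ => hw x
  have htpos : 0 < t := by linarith [weight_pos h0 h1 y y]
  have hsq := sum_eq_puncturedBall hη y fun x => weight δ x y ^ 2
  rw [sum_weight_sq] at hsq
  have hfar : ∑ x with ¬ (hammingDist x y : ℝ) ≤ η * n, weight δ x y ^ 2 ≤
      (∑ x with ¬ (hammingDist x y : ℝ) ≤ η * n, weight δ x y) ^ 2 :=
    Finset.sum_sq_le_sq_sum_of_nonneg fun x _ => hw x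
  -- Removing `y` and the far points costs at most `t²` of a variance of at least `16t²`, leaving
  -- more than the required `8t²`.
  have hsum : weight δ y y ^ 2 + ∑ x with ¬ (hammingDist x y : ℝ) ≤ η * n, weight δ x y ^ 2 ≤
      t ^ 2 := by
    have := pow_le_pow_left₀ (add_nonneg (hw y) hfar0) ht 2
    nlinarith [mul_nonneg (hw y) hfar0]
  have ht2 : 0 < t ^ 2 := by positivity
  have hy : y ∉ puncturedBall η y := Finset.notMem_erase _ _
  exact card_le_eight_mul_card_mul_signSum_lt (fun x => weight δ x y) hy
    (by linarith) (by linarith)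

theorem fractionSP_le {δ η : ℝ} (h0 : 0 < δ) (h1 : δ < 1) (hδη : δ < η) (hη : η < 1 / 4) {n : ℕ}
    (hn : 16 * ((1 - δ) ^ n + ((2 : ℝ) ^ (-binDiv η δ)) ^ n) ^ 2 ≤ (δ ^ 2 + (1 - δ) ^ 2) ^ n) :
    fractionSP (1 - 2 * δ) n ≤ Real.exp (-((2 : ℝ) ^ (n * (1 - binEnt (2 * η))) / 8)) := by
  classical
  have hη0 : 0 < η := h0.trans hδη
  obtain ⟨C, hC, hcard⟩ := exists_code (l := 2 * η) (by linarith) (by linarith) n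
  set t : ℝ := (1 - δ) ^ n + ((2 : ℝ) ^ (-binDiv η δ)) ^ n with ht
  have hty : ∀ y : Cube n,
      weight δ y y + ∑ x with ¬ (hammingDist x y : ℝ) ≤ η * n, weight δ x y ≤ t := by
    intro y
    rw [weight_self]
    exact add_le_add_right (sum_weight_far_le h0 hδη (by linarith) y) _
  have hN : (0 : ℝ) < Fintype.card (BoolFn n) := by exact_mod_cast Fintype.card_pos
  let P : Cube n → BoolFn n → Prop := fun y f =>
    ¬ ((f y : ℤ) : ℝ) * signSum (fun x => weight δ x y) (puncturedBall η y) f < -t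
  have hP : ∀ y ∈ C, (#{f : BoolFn n | P y f} : ℝ) ≤ 7 / 8 * Fintype.card (BoolFn n) := by
    intro y _
    have hb := card_le_eight_mul_card_bad h0 h1 hη0.le y (hty y) hn
    have hs := Finset.card_filter_add_card_filter_not (s := (univ : Finset (BoolFn n)))
      (fun f : BoolFn n =>
        ((f y : ℤ) : ℝ) * signSum (fun x => weight δ x y) (puncturedBall η y) f < -t)
    rw [Finset.card_univ] at hs
    have hs' : (#{f : BoolFn n |
        ((f y : ℤ) : ℝ) * signSum (fun x => weight δ x y) (puncturedBall η y) f < -t} : ℝ) +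
        #{f : BoolFn n | P y f} = Fintype.card (BoolFn n) := by exact_mod_cast hs
    linarith
  have hforall := card_forall_le_pow_mul_card C P
    (fun y => {x : Cube n | (hammingDist x y : ℝ) ≤ η * n}) (by
      intro y hy z hz hyz
      refine Finset.disjoint_left.2 fun x hxy hxz => ?_
      simp only [Finset.mem_filter, Finset.mem_univ, true_and] at hxy hxz
      have htri : (hammingDist y z : ℝ) ≤ hammingDist x y + hammingDist x z := by
        rw [hammingDist_comm x y]
        exact_mod_cast hammingDist_triangle y x z
      linarith [hC y hy z hz hyz]) (by
      intro y f g hfg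
      have hy : f y = g y := hfg y (by
        simp only [Finset.mem_filter, Finset.mem_univ, true_and, hammingDist_self, Nat.cast_zero]
        positivity)
      have hs : signSum (fun x => weight δ x y) (puncturedBall η y) f =
          signSum (fun x => weight δ x y) (puncturedBall η y) g :=
        Finset.sum_congr rfl fun x hx => by rw [hfg x (Finset.mem_of_mem_erase hx)]
      simp only [P, hy, hs]) hP
  calc fractionSP (1 - 2 * δ) n ≤ (7 / 8) ^ #C := by
        rw [fractionSP, Nat.card_eq_fintype_card (α := BoolFn n), div_le_iff₀ hN]
        refine le_trans ?_ hforall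
        rw [Nat.card_eq_fintype_card, Fintype.card_subtype]
        refine Nat.cast_le.2 (Finset.card_le_card fun f hf => ?_)
        simp only [Finset.mem_filter, Finset.mem_univ, true_and] at hf ⊢
        exact fun y _ hlt => not_isSPAt h0 h1 hη0.le (hty y) hlt (hf y)
    _ ≤ Real.exp (-(1 / 8)) ^ #C := by
        gcongr
        linarith [Real.add_one_le_exp (-(1 / 8) : ℝ)]
    _ = Real.exp (-(#C / 8)) := by
        rw [← Real.exp_nat_mul]
        ring_nf
    _ ≤ _ := by
        gcongr

theorem eventually_noise_le {p q s : ℝ} (hs : 0 < s)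
    (hps : p ^ 2 < s) (hqs : q ^ 2 < s) :
    ∀ᶠ n : ℕ in atTop, 16 * (p ^ n + q ^ n) ^ 2 ≤ s ^ n := by
  have h1 : Tendsto (fun n : ℕ => 32 * ((p ^ 2 / s) ^ n + (q ^ 2 / s) ^ n)) atTop
      (nhds (32 * (0 + 0))) :=
    ((tendsto_pow_atTop_nhds_zero_of_lt_one (by positivity) ((div_lt_one hs).2 hps)).add
      (tendsto_pow_atTop_nhds_zero_of_lt_one (by positivity) ((div_lt_one hs).2 hqs))).const_mul 32
  filter_upwards [h1.eventually_lt_const (u := 1) (by norm_num)] with n hn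
  have hsn : 0 < s ^ n := by positivity
  rw [div_pow, div_pow, ← add_div, ← mul_div_assoc, div_lt_one hsn, ← pow_mul, ← pow_mul,
    mul_comm 2 n, pow_mul, pow_mul] at hn
  nlinarith [sq_nonneg (p ^ n - q ^ n)]

theorem eventually_fractionSP_le {δ : ℝ} (h0 : 0 < δ) (h1 : δ < 1) (hη : eta δ < 1 / 4) {ε : ℝ}
    (hε : 0 < ε) :
    ∀ᶠ n : ℕ in atTop, fractionSP (1 - 2 * δ) n ≤
      Real.exp (-((2 : ℝ) ^ ((n : ℝ) * (1 - binEnt (2 * eta δ)) - ε * n))) := by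
  have hcont : ContinuousAt (fun η => binEnt (2 * η)) (eta δ) :=
    (continuous_binEnt.comp (continuous_const.mul continuous_id)).continuousAt
  obtain ⟨r, hr, hball⟩ := Metric.eventually_nhds_iff.1
    (hcont.eventually_lt (continuousAt_const (y := binEnt (2 * eta δ) + ε / 2)) (by linarith))
  -- An admissible radius close enough to the infimum loses at most `ε/2` in the rate.
  obtain ⟨η, hηS, hηlt⟩ := exists_lt_of_csInf_lt (etaSet_nonempty h0 h1)
    (show sInf (etaSet δ) < min (1 / 4) (eta δ + r) from lt_min hη (by
      change eta δ < _
      linarith))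
  obtain ⟨hη4, hηr⟩ := lt_min_iff.1 hηlt
  have hle : eta δ ≤ η := csInf_le (etaSet_bddBelow δ) hηS
  have hh : binEnt (2 * η) < binEnt (2 * eta δ) + ε / 2 :=
    hball (by rw [Real.dist_eq, abs_lt]; constructor <;> linarith)
  have hD := (etaCondition_iff h0 h1 η).1 hηS.2.2
  have hs := sq_add_sq_one_sub_pos δ
  have hq : ((2 : ℝ) ^ (-binDiv η δ)) ^ 2 < δ ^ 2 + (1 - δ) ^ 2 := by
    rw [← Real.log_lt_log_iff (by positivity) hs, Real.log_pow, Real.log_rpow two_pos]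
    have h2 := mul_lt_mul_of_pos_left hD (Real.log_pos one_lt_two)
    rw [log_two_mul_threshold] at h2
    push_cast
    linarith
  -- Then `εn/2 ≥ 3`, so the other half of `ε` absorbs the factor `1/8 = 2^(-3)`.
  have hlarge : ∀ᶠ n : ℕ in atTop, 6 / ε ≤ (n : ℝ) :=
    tendsto_natCast_atTop_atTop.eventually_ge_atTop _
  filter_upwards [eventually_noise_le hs
    (show (1 - δ) ^ 2 < δ ^ 2 + (1 - δ) ^ 2 by nlinarith) hq, hlarge] with n hn hnl
  refine (fractionSP_le h0 h1 hηS.1 hη4 hn).trans (Real.exp_le_exp.2 (neg_le_neg ?_))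
  rw [le_div_iff₀ (by norm_num), show (8 : ℝ) = 2 ^ (3 : ℝ) by norm_num, ← Real.rpow_add two_pos]
  refine Real.rpow_le_rpow_of_exponent_le one_le_two ?_
  rw [div_le_iff₀ hε] at hnl
  have := mul_le_mul_of_nonneg_left hh.le (Nat.cast_nonneg (α := ℝ) n)
  linarith

/-- Exponential bounds that lose an arbitrarily small rate combine into one that loses `o(n)`. -/
theorem exists_isLittleO_of_forall_pos {u : ℕ → ℝ} (hu : ∀ n, 0 ≤ u n) {c : ℝ}
    (h : ∀ ε > 0, ∀ᶠ n : ℕ in atTop, u n ≤ Real.exp (-((2 : ℝ) ^ ((n : ℝ) * c - ε * n)))) :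
    ∃ e : ℕ → ℝ, e =o[atTop] (fun n : ℕ => (n : ℝ)) ∧
      ∀ᶠ n : ℕ in atTop, u n ≤ Real.exp (-((2 : ℝ) ^ ((n : ℝ) * c - e n))) := by
  classical
  -- The least nonnegative error that makes the bound hold when `0 < u n < 1`; for `u n = 0` any
  -- value works.
  let e : ℕ → ℝ := fun n =>
    if u n = 0 then 0 else max 0 (n * c - Real.logb 2 (-Real.log (u n)))
  have key : ∀ n x, u n ≠ 0 → u n ≤ Real.exp (-((2 : ℝ) ^ x)) →
      0 < -Real.log (u n) ∧ x ≤ Real.logb 2 (-Real.log (u n)) := by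
    intro n x hn hx
    have hpos : 0 < u n := lt_of_le_of_ne (hu n) hn.symm
    have h1 : (2 : ℝ) ^ x ≤ -Real.log (u n) := by
      have := Real.log_le_log hpos hx
      rw [Real.log_exp] at this
      linarith
    have h2 : 0 < -Real.log (u n) := lt_of_lt_of_le (by positivity) h1
    exact ⟨h2, (Real.le_logb_iff_rpow_le one_lt_two h2).2 h1⟩
  refine ⟨e, ?_, ?_⟩
  · rw [isLittleO_iff]
    intro ε hε
    filter_upwards [h ε hε] with n hn
    have he0 : 0 ≤ e n := by
      simp only [e]
      split_ifs
      · exact le_rfl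
      · exact le_max_left _ _
    rw [Real.norm_of_nonneg he0, Real.norm_of_nonneg (Nat.cast_nonneg n)]
    simp only [e]
    split_ifs with h0
    · positivity
    · refine max_le (by positivity) ?_
      linarith [(key n _ h0 hn).2]
  -- Any rate would do: it only ensures `u n < 1`, so that `-log (u n)` is positive.
  · filter_upwards [h 1 one_pos] with n hn
    by_cases h0 : u n = 0
    · rw [h0]
      positivity
    · obtain ⟨hlog, -⟩ := key n _ h0 hn
      have hpos : 0 < u n := lt_of_le_of_ne (hu n) (Ne.symm h0)
      have he : (n : ℝ) * c - Real.logb 2 (-Real.log (u n)) ≤ e n := by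
        simp only [e, if_neg h0]
        exact le_max_right _ _
      rw [← Real.log_le_iff_le_exp hpos, le_neg, ← Real.le_logb_iff_rpow_le one_lt_two hlog]
      linarith

end SelfPredicting

theorem mainTheorem2 :
    |SelfPredicting.deltaMax - 0.0974| ≤ 0.00005 ∧
    ∀ δ : ℝ, 0 < δ → δ < SelfPredicting.deltaMax →
      (δ < SelfPredicting.eta δ ∧ SelfPredicting.eta δ < 1 / 4) ∧
      ∃ e : ℕ → ℝ, e =o[atTop] (fun n : ℕ => (n : ℝ)) ∧
        ∀ᶠ n : ℕ in atTop,
          SelfPredicting.fractionSP (1 - 2 * δ) n ≤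
            Real.exp (-((2 : ℝ) ^
              ((n : ℝ) * (1 - SelfPredicting.binEnt (2 * SelfPredicting.eta δ)) - e n))) := by
  refine ⟨SelfPredicting.abs_deltaMax_sub_le, fun δ h0 hδ => ?_⟩
  obtain ⟨h1, hη⟩ := SelfPredicting.eta_lt_quarter_of_lt_deltaMax h0 hδ
  have h2 : δ < 1 := by linarith
  refine ⟨⟨SelfPredicting.lt_eta h0 h2, hη⟩, ?_⟩
  refine SelfPredicting.exists_isLittleO_of_forall_pos (fun n => ?_)
    fun ε hε => SelfPredicting.eventually_fractionSP_le h0 h2 hη hε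
  rw [SelfPredicting.fractionSP]
  positivity
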